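/- Let $k\ge 2$ be an integer, and for $|x|<1$ let $\ln_k x=\sum_{n\ge 1}x^n/n^k$ (the principal branch of the $k$th polylogarithm). Write $\mathbb{Z}(k)=(2\pi i)^k\mathbb{Z}\subset\mathbb{C}$. Let $V\subset\mathbb{C}\setminus\{0,1\}$ be any convex open set whose closure contains $1$ (for example the disk $|x-1/2|<1/2$), let $p\in V$, and let $\gamma$ be any path in $\mathbb{C}\setminus\{0,1\}$ from $1/2$ to $p$. Then the principal branch of $\ln_k$ can be continued analytically along $\gamma$, the resulting germ at $p$ extends to a holomorphic function $F$ on $V$ (a branch of $\ln_k$ on $V$), and the limit $F(1):=\lim_{x\to 1,\,x\in V}F(x)$ exists. Although $F(1)$ depends on the choice of the branch, the class of $(k-1)!\,F(1)$ in $\mathbb{C}/\mathbb{Z}(k)$ does not depend on $V$, $p$ and $\gamma$: the value of $(k-1)!\ln_k 1$ is well defined modulo $\mathbb{Z}(k)$, and $$(k-1)!\,\ln_k 1\equiv (k-1)!\,\zeta(k)\pmod{\mathbb{Z}(k)}.$$ -/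

import Mathlib

open Filter Topology

noncomputable section

/-- The power series `∑_{n ≥ 1} xⁿ / n ^ k`. On the open unit disk it is the principal branch of
the `k`-th polylogarithm. -/
def polylogSeries (k : ℕ) (x : ℂ) : ℂ :=
  ∑' n : ℕ, x ^ (n + 1) / ((n : ℂ) + 1) ^ k

/-- The germ of `g` at the end point of `γ` is the analytic continuation along `γ` of the germ of
`f` at the starting point: there are analytic germs `h t` at the points `γ t`, which are locally
constant in `t` (for `s` near `t` the germ `h s` is the one that `h t` induces at `γ s`), beginning
with `f` and ending with `g`. -/
def IsAnalyticContinuationAlong {a b : ℂ} (γ : Path a b) (f g : ℂ → ℂ) : Prop :=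
  ∃ h : unitInterval → ℂ → ℂ,
    (∀ t, AnalyticAt ℂ (h t) (γ t)) ∧
    (∀ t, ∀ᶠ s in 𝓝 t, h s =ᶠ[𝓝 (γ s)] h t) ∧
    h 0 =ᶠ[𝓝 a] f ∧
    h 1 =ᶠ[𝓝 b] g

/-- `F` is, on the region `V`, the branch of the `k`-th polylogarithm obtained by continuing the
principal branch from `1/2` to the end point `p` along `γ`. -/
def IsPolylogBranchAlong (k : ℕ) {p : ℂ} (γ : Path (1 / 2 : ℂ) p) (V : Set ℂ) (F : ℂ → ℂ) : Prop :=
  AnalyticOnNhd ℂ F V ∧ IsAnalyticContinuationAlong γ (polylogSeries k) F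

/-- A convex region of `ℂ - {0, 1}` that has `1` in its closure (for instance the disk
`|x - 1/2| < 1/2`). -/
structure IsConvexRegionAtOne (V : Set ℂ) : Prop where
  isOpen : IsOpen V
  convex : Convex ℝ V
  zero_notMem : (0 : ℂ) ∉ V
  one_notMem : (1 : ℂ) ∉ V
  one_mem_closure : (1 : ℂ) ∈ closure V

/-- All values at `1` of the multivalued function `ln_k` on `ℂ - {0, 1}`: the limits at `1` of its
branches on convex regions of `ℂ - {0, 1}` adherent to `1`. -/
def polylogValuesAtOne (k : ℕ) : Set ℂ :=
  {L | ∃ V : Set ℂ, IsConvexRegionAtOne V ∧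
    ∃ p ∈ V, ∃ γ : Path (1 / 2 : ℂ) p, (∀ t, γ t ≠ 0 ∧ γ t ≠ 1) ∧
      ∃ F : ℂ → ℂ, IsPolylogBranchAlong k γ V F ∧ Tendsto F (𝓝[V] 1) (𝓝 L)}

/-- The subgroup `ℤ(k) = (2πi)^k ℤ` of `ℂ`. -/
def tateIntegers (k : ℕ) : AddSubgroup ℂ :=
  AddSubgroup.zmultiples ((2 * (Real.pi : ℂ) * Complex.I) ^ k)

end

/-! Put `k = m + 1`. Two charts cover `ℂ`. On `Re z < 1` the power series extends to a holomorphic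
`Li`. On the slit plane `Li z = A z - log z ^ m / m! * log (1 - z)`, with `A` holomorphic even at
`1` (`exists_isPolylogPair`). Every branch is `Li + P (l)` in the first chart and `A - log ^ m / m!
* u + P (log)` in the second, where `l` and `u` are local logarithms of `z` and `1 - z` and `P` is
entire with `m! P (2πin) ∈ ℤ(k)` for all integers `n`. Another `l` translates `P` by a period;
another `u` adds a multiple of `2πi w ^ m / m!` to `P`. Both preserve the condition on `P`, so this
class of germs is stable under continuation (`IsPolylogGerm.of_continuation`), and each such germ
extends over convex regions inside a chart, which gives existence. At `1` the logarithmic term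
vanishes because `m ≥ 1`, so the limit is `A 1 + P 0 = ζ(k) + P 0`, and `m! P 0 ∈ ℤ(k)`
(`IsPolylogPair.exists_tendsto`). -/

/-! ### Holomorphic primitives. -/

theorem Convex.exists_hasDerivAt_of_differentiableOn {f : ℂ → ℂ} {s : Set ℂ} (hs : Convex ℝ s)
    (ho : IsOpen s) (hf : DifferentiableOn ℂ f s) (a c : ℂ) :
    ∃ g : ℂ → ℂ, (∀ z ∈ s, HasDerivAt g (f z) z) ∧ g a = c := by
  obtain ⟨g, hg⟩ := hs.exists_forall_hasDerivWithinAt hf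
  exact ⟨fun z => g z + (c - g a),
    fun z hz => ((hg z hz).hasDerivAt (ho.mem_nhds hz)).add_const _, by simp⟩

/-- The slit plane is not convex, but `exp` maps the convex strip `|Im w| < π` onto it: integrate `f
(exp w) * exp w` there and compose with `log`. -/
theorem Complex.exists_hasDerivAt_of_differentiableOn_slitPlane {f : ℂ → ℂ}
    (hf : DifferentiableOn ℂ f Complex.slitPlane) (a c : ℂ) :
    ∃ g : ℂ → ℂ, (∀ z ∈ Complex.slitPlane, HasDerivAt g (f z) z) ∧ g a = c := by
  let s : Set ℂ := Complex.imLm ⁻¹' Set.Ioo (-Real.pi) Real.pi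
  have hs : Convex ℝ s := (convex_Ioo _ _).linear_preimage _
  have ho : IsOpen s := isOpen_Ioo.preimage Complex.continuous_im
  have hexp : ∀ w ∈ s, Complex.exp w ∈ Complex.slitPlane := by
    intro w hw
    rw [Complex.mem_slitPlane_iff_arg]
    refine ⟨?_, Complex.exp_ne_zero w⟩
    rw [← Complex.log_im, Complex.log_exp hw.1 hw.2.le]
    exact hw.2.ne
  obtain ⟨g, hg, -⟩ := hs.exists_hasDerivAt_of_differentiableOn ho
    (f := fun w => f (Complex.exp w) * Complex.exp w)
    ((hf.comp Complex.differentiable_exp.differentiableOn hexp).mul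
      Complex.differentiable_exp.differentiableOn) 0 0
  refine ⟨fun z => g (Complex.log z) + (c - g (Complex.log a)), fun z hz => ?_, by simp⟩
  have hz0 : z ≠ 0 := Complex.slitPlane_ne_zero hz
  have hlog : Complex.log z ∈ s := by
    refine ⟨by simpa using Complex.neg_pi_lt_log_im z, ?_⟩
    have h := (Complex.mem_slitPlane_iff_arg.1 hz).1
    have h2 := Complex.log_im_le_pi z
    rw [← Complex.log_im] at h
    exact lt_of_le_of_ne h2 h
  have h := ((hg _ hlog).comp z (Complex.hasDerivAt_log hz)).add_const (c - g (Complex.log a))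
  rw [Complex.exp_log hz0, mul_assoc, mul_inv_cancel₀ hz0, mul_one] at h
  exact h

/-! ### The power series in the unit disk. -/

theorem polylogSeries_zero_right (k : ℕ) : polylogSeries k 0 = 0 := by
  simp [polylogSeries]

theorem polylogSeries_one {z : ℂ} (hz : ‖z‖ < 1) :
    polylogSeries 1 z = -Complex.log (1 - z) := by
  have h := Complex.hasSum_taylorSeries_neg_log hz
  rw [polylogSeries, ← h.tsum_eq, h.summable.tsum_eq_zero_add]
  simp

theorem norm_div_natCast_add_one_pow_le (a : ℂ) (n k : ℕ) :
    ‖a / ((n : ℂ) + 1) ^ k‖ ≤ ‖a‖ := by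
  rw [norm_div, norm_pow]
  refine div_le_self (norm_nonneg a) (one_le_pow₀ ?_)
  rw [show (n : ℂ) + 1 = ((n + 1 : ℕ) : ℂ) by push_cast; rfl, Complex.norm_natCast]
  push_cast
  linarith [n.cast_nonneg (α := ℝ)]

/-- Termwise differentiation. Since the series vanishes at `0`, `dslope` is the quotient by `z` with
its removable singularity filled in. -/
theorem hasDerivAt_polylogSeries (k : ℕ) {z : ℂ} (hz : ‖z‖ < 1) :
    HasDerivAt (polylogSeries (k + 1)) (dslope (polylogSeries k) 0 z) z := by
  obtain ⟨r, hzr, hr⟩ := exists_between hz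
  have hr0 : 0 < r := (norm_nonneg z).trans_lt hzr
  have hsum : HasDerivAt (polylogSeries (k + 1)) (∑' n : ℕ, z ^ n / ((n : ℂ) + 1) ^ k) z := by
    refine hasDerivAt_tsum_of_isPreconnected
      (g := fun (n : ℕ) (y : ℂ) => y ^ (n + 1) / ((n : ℂ) + 1) ^ (k + 1))
      (g' := fun (n : ℕ) (y : ℂ) => y ^ n / ((n : ℂ) + 1) ^ k) (y₀ := 0)
      (summable_geometric_of_lt_one hr0.le hr)
      Metric.isOpen_ball (convex_ball (0 : ℂ) r).isPreconnected (fun n y _ => ?_)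
      (fun n y hy => ?_) (Metric.mem_ball_self hr0) ?_ (by simpa using hzr)
    · have h := (hasDerivAt_pow (n + 1) y).div_const (((n : ℂ) + 1) ^ (k + 1))
      refine h.congr_deriv ?_
      have : (n : ℂ) + 1 ≠ 0 := by exact_mod_cast n.succ_ne_zero
      push_cast
      field_simp
      ring
    · exact (norm_div_natCast_add_one_pow_le _ n k).trans (by
        rw [norm_pow]
        exact pow_le_pow_left₀ (norm_nonneg y) (mem_ball_zero_iff.1 hy).le n)
    · simp [summable_zero]
  have hmul (w : ℂ) : polylogSeries k w = w * ∑' n : ℕ, w ^ n / ((n : ℂ) + 1) ^ k := by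
    rw [polylogSeries, ← tsum_mul_left]
    exact tsum_congr fun n => by ring
  refine hsum.congr_deriv ?_
  rcases eq_or_ne z 0 with rfl | h0
  · have hcont : ContinuousAt (fun w : ℂ => ∑' n : ℕ, w ^ n / ((n : ℂ) + 1) ^ k) 0 := by
      refine ContinuousOn.continuousAt (s := Metric.ball 0 r) ?_ (Metric.ball_mem_nhds _ hr0)
      refine continuousOn_tsum (fun n => by fun_prop)
        (summable_geometric_of_lt_one hr0.le hr) fun n y hy => ?_
      exact (norm_div_natCast_add_one_pow_le _ n k).trans (by
        rw [norm_pow]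
        exact pow_le_pow_left₀ (norm_nonneg y) (mem_ball_zero_iff.1 hy).le n)
    rw [dslope_same]
    refine (HasDerivAt.deriv ?_).symm
    rw [hasDerivAt_iff_tendsto_slope_zero]
    refine (hcont.tendsto.mono_left nhdsWithin_le_nhds).congr' ?_
    filter_upwards [self_mem_nhdsWithin] with t ht
    have ht : t ≠ 0 := ht
    rw [zero_add, polylogSeries_zero_right, sub_zero, hmul, smul_eq_mul, inv_mul_cancel_left₀ ht]
  · rw [dslope_of_ne _ h0, slope_def_field, polylogSeries_zero_right, hmul]
    field_simp
    simp

/-! ### The two charts and the regular part at `1`. -/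

theorem isPreconnected_re_lt_one_inter_slitPlane :
    IsPreconnected ({z : ℂ | z.re < 1} ∩ Complex.slitPlane) := by
  have h1 : StarConvex ℝ ((1 / 2 : ℝ) : ℂ) {z : ℂ | z.re < 1} :=
    (convex_halfSpace_re_lt 1).starConvex (by simp; norm_num)
  have h2 := h1.inter (Complex.starConvex_ofReal_slitPlane (x := 1 / 2) (by norm_num))
  exact (h2.isPathConnected
    ⟨by norm_num, Or.inl (by norm_num)⟩).isConnected.isPreconnected

theorem one_sub_mem_slitPlane {z : ℂ} (hz : z.re < 1) : 1 - z ∈ Complex.slitPlane :=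
  Or.inl (by simpa using hz)

/-- The pair of functions describing the polylogarithm of weight `m + 1`: `Li` extends the power
series to `Re z < 1`, and `A` is the regular part on the slit plane, including the point `1`. -/
structure IsPolylogPair (m : ℕ) (Li A : ℂ → ℂ) : Prop where
  differentiableOn_left : DifferentiableOn ℂ Li {z : ℂ | z.re < 1}
  differentiableOn_right : DifferentiableOn ℂ A Complex.slitPlane
  eq_series : ∀ z : ℂ, ‖z‖ < 1 → Li z = polylogSeries (m + 1) z
  eq_overlap : ∀ z : ℂ, z.re < 1 → z ∈ Complex.slitPlane →
    Li z = A z - Complex.log z ^ m / (m.factorial : ℂ) * Complex.log (1 - z)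

/-- Induction on the weight, integrating `dz / z`, from `-log (1 - z)` with regular part `0`. -/
theorem exists_isPolylogPair (m : ℕ) : ∃ Li A : ℂ → ℂ, IsPolylogPair m Li A := by
  have hH : IsOpen {z : ℂ | z.re < 1} := isOpen_lt Complex.continuous_re continuous_const
  induction m with
  | zero =>
    refine ⟨fun z => -Complex.log (1 - z), fun _ => 0, ?_, differentiableOn_const _, ?_, ?_⟩
    · exact ((differentiableOn_const _).sub differentiableOn_id).clog
        (fun z hz => one_sub_mem_slitPlane hz) |>.neg
    · exact fun z hz => (polylogSeries_one hz).symm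
    · simp
  | succ m ih =>
    obtain ⟨Li, A, h⟩ := ih
    have hLi0 : Li 0 = 0 := by rw [h.eq_series 0 (by simp), polylogSeries_zero_right]
    obtain ⟨Li', hLi', hLi'0⟩ := (convex_halfSpace_re_lt 1).exists_hasDerivAt_of_differentiableOn hH
      ((Complex.differentiableOn_dslope (hH.mem_nhds (by simp : (0 : ℂ).re < 1))).2
        h.differentiableOn_left) 0 0
    have hlog : DifferentiableOn ℂ Complex.log Complex.slitPlane :=
      fun z hz => (Complex.differentiableAt_log hz).differentiableWithinAt
    have hlog1 : DifferentiableOn ℂ (dslope Complex.log 1) Complex.slitPlane :=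
      (Complex.differentiableOn_dslope
        (Complex.isOpen_slitPlane.mem_nhds Complex.one_mem_slitPlane)).2 hlog
    -- Differentiating the desired overlap formula forces this integrand: the pole of `log z ^ (m +
    -- 1) / (z - 1)` at `1` is cancelled by one factor `log z`, leaving `dslope`. The constant of
    -- integration makes the formula true at `1 / 2`.
    obtain ⟨A', hA', hA'0⟩ := Complex.exists_hasDerivAt_of_differentiableOn_slitPlane
      (f := fun z => A z / z + Complex.log z ^ m * dslope Complex.log 1 z /
        ((m + 1).factorial : ℂ))
      ((h.differentiableOn_right.div differentiableOn_id
        fun z hz => Complex.slitPlane_ne_zero hz).add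
        (((hlog.pow m).mul hlog1).div_const _)) (1 / 2)
      (Li' (1 / 2) + Complex.log (1 / 2) ^ (m + 1) / ((m + 1).factorial : ℂ) *
        Complex.log (1 - 1 / 2))
    refine ⟨Li', A', fun z hz => (hLi' z hz).differentiableAt.differentiableWithinAt,
      fun z hz => (hA' z hz).differentiableAt.differentiableWithinAt, ?_, ?_⟩
    · have hball : ∀ z ∈ Metric.ball (0 : ℂ) 1, z.re < 1 := fun z hz =>
        (Complex.re_le_norm z).trans_lt (by simpa using hz)
      have hd : ∀ z ∈ Metric.ball (0 : ℂ) 1,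
          HasDerivAt (polylogSeries (m + 1 + 1)) (dslope Li 0 z) z := by
        intro z hz
        refine (hasDerivAt_polylogSeries (m + 1) (by simpa using hz)).congr_deriv ?_
        rcases eq_or_ne z 0 with rfl | h0
        · rw [dslope_same, dslope_same]
          refine Filter.EventuallyEq.deriv_eq ?_
          filter_upwards [Metric.ball_mem_nhds (0 : ℂ) one_pos] with w hw
          exact (h.eq_series w (by simpa using hw)).symm
        · rw [dslope_of_ne _ h0, dslope_of_ne _ h0, slope_def_field, slope_def_field, hLi0,
            polylogSeries_zero_right, h.eq_series z (by simpa using hz)]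
      intro z hz
      refine Metric.isOpen_ball.eqOn_of_deriv_eq (convex_ball (0 : ℂ) 1).isPreconnected
        (fun w hw => (hLi' w (hball w hw)).differentiableAt.differentiableWithinAt)
        (fun w hw => (hd w hw).differentiableAt.differentiableWithinAt)
        (fun w hw => (hLi' w (hball w hw)).deriv.trans (hd w hw).deriv.symm)
        (Metric.mem_ball_self one_pos) ?_ (by simpa using hz)
      rw [hLi'0, polylogSeries_zero_right]
    · have hd : ∀ z ∈ {z : ℂ | z.re < 1} ∩ Complex.slitPlane,
          HasDerivAt (fun z => A' z - Complex.log z ^ (m + 1) / ((m + 1).factorial : ℂ) *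
            Complex.log (1 - z)) (dslope Li 0 z) z := by
        rintro z ⟨hz1, hz⟩
        have hz0 : z ≠ 0 := Complex.slitPlane_ne_zero hz
        have hne : 1 - z ≠ 0 := Complex.slitPlane_ne_zero (one_sub_mem_slitPlane hz1)
        have hne1 : z ≠ 1 := fun h => hne (by simp [h])
        have h1 : HasDerivAt (fun z : ℂ => Complex.log (1 - z)) (-1 / (1 - z)) z :=
          ((hasDerivAt_id z).const_sub 1).clog (one_sub_mem_slitPlane hz1)
        have h2 := (((Complex.hasDerivAt_log hz).pow (m + 1)).div_const
          ((m + 1).factorial : ℂ)).mul h1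
        refine ((hA' z hz).sub h2).congr_deriv ?_
        rw [dslope_of_ne _ hz0, dslope_of_ne _ hne1, slope_def_field, slope_def_field, hLi0,
          h.eq_overlap z hz1 hz, Complex.log_one]
        have hf : (m.factorial : ℂ) ≠ 0 := by exact_mod_cast m.factorial_ne_zero
        have hm : (m : ℂ) + 1 ≠ 0 := by exact_mod_cast m.succ_ne_zero
        have hne2 : z - 1 ≠ 0 := sub_ne_zero.2 hne1
        rw [show (1 - z) = -(z - 1) by ring, Nat.factorial_succ]
        push_cast
        simp only [Pi.pow_apply, sub_zero]
        field_simp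
        ring
      intro z hz1 hz
      refine (hH.inter Complex.isOpen_slitPlane).eqOn_of_deriv_eq
        isPreconnected_re_lt_one_inter_slitPlane
        (fun w hw => (hLi' w hw.1).differentiableAt.differentiableWithinAt)
        (fun w hw => (hd w hw).differentiableAt.differentiableWithinAt)
        (fun w hw => (hLi' w hw.1).deriv.trans (hd w hw).deriv.symm)
        (x := 1 / 2) ⟨by norm_num, Or.inl (by norm_num)⟩ ?_ ⟨hz1, hz⟩
      simp only [hA'0]
      ring

/-! ### Behaviour at `1`. -/

theorem summable_one_div_add_one_pow {k : ℕ} (hk : 2 ≤ k) :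
    Summable fun n : ℕ => 1 / ((n : ℝ) + 1) ^ k := by
  have h := (summable_nat_add_iff 1).2 (Real.summable_one_div_nat_pow.2 (by lia : 1 < k))
  simpa using h

theorem polylogSeries_one_right {k : ℕ} (hk : 2 ≤ k) :
    polylogSeries k 1 = riemannZeta (k : ℂ) := by
  have hs : Summable fun n : ℕ => 1 / (n : ℂ) ^ k := by
    have h := Real.summable_one_div_nat_pow.2 (by lia : 1 < k)
    have h2 := Complex.ofRealCLM.summable h
    simpa using h2
  rw [zeta_nat_eq_tsum_of_gt_one (by lia), hs.tsum_eq_zero_add, polylogSeries]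
  simp [show k ≠ 0 by lia]

theorem continuousOn_polylogSeries {k : ℕ} (hk : 2 ≤ k) :
    ContinuousOn (polylogSeries k) (Metric.closedBall 0 1) := by
  refine continuousOn_tsum (fun n => by fun_prop) (summable_one_div_add_one_pow hk)
    fun n y hy => ?_
  rw [norm_div, norm_pow, norm_pow,
    show (n : ℂ) + 1 = ((n + 1 : ℕ) : ℂ) by push_cast; rfl, Complex.norm_natCast]
  push_cast
  gcongr
  exact pow_le_one₀ (norm_nonneg y) (by simpa using hy)

/-- One factor `log z = O(1 - z)` beats the logarithm, as `u log u → 0`. The constant `b` allows for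
the rotated logarithms of `1 - z` used on convex regions. -/
theorem tendsto_log_pow_mul_log {m : ℕ} (hm : 1 ≤ m) {b : ℂ} (hb : b ≠ 0) :
    Tendsto (fun z : ℂ => Complex.log z ^ m * Complex.log (b * (1 - z))) (𝓝[≠] 1) (𝓝 0) := by
  obtain ⟨j, rfl⟩ := Nat.exists_eq_add_of_le' hm
  have hlogc : ContinuousAt Complex.log 1 :=
    (Complex.differentiableAt_log Complex.one_mem_slitPlane).continuousAt
  have hO : Complex.log =O[𝓝 1] fun z => 1 - z := by
    have h := (Complex.hasDerivAt_log Complex.one_mem_slitPlane).isBigO_sub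
    simp only [Complex.log_one, sub_zero] at h
    exact h.trans (Asymptotics.isBigO_of_le _ fun z => by rw [norm_sub_rev])
  have hu : Tendsto (fun z : ℂ => b * (1 - z)) (𝓝[≠] 1) (𝓝[≠] 0) := by
    refine tendsto_nhdsWithin_iff.2 ⟨?_, ?_⟩
    · have : ContinuousAt (fun z : ℂ => b * (1 - z)) 1 := by fun_prop
      simpa using this.tendsto.mono_left nhdsWithin_le_nhds
    · filter_upwards [self_mem_nhdsWithin] with z hz
      exact mul_ne_zero hb (sub_ne_zero.2 (Ne.symm hz))
  have hlim : Tendsto (fun u : ℂ => u * Complex.log u) (𝓝[≠] 0) (𝓝 0) := by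
    have hn : Tendsto (fun u : ℂ => ‖u‖) (𝓝[≠] 0) (𝓝[>] 0) := tendsto_norm_nhdsNE_zero
    have h1 : Tendsto (fun u : ℂ => ‖u‖ * |Real.log ‖u‖| + ‖u‖ * Real.pi) (𝓝[≠] 0) (𝓝 0) := by
      have h2 := ((tendsto_log_mul_rpow_nhdsGT_zero one_pos).comp hn).abs
      have h3 := ((hn.mono_right nhdsWithin_le_nhds).mul_const Real.pi)
      have h4 := h2.add h3
      simp only [abs_zero, zero_mul, add_zero] at h4
      refine h4.congr fun u => ?_
      simp [abs_mul, mul_comm]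
    refine squeeze_zero_norm (fun u => ?_) h1
    rw [norm_mul, ← mul_add]
    gcongr
    refine (Complex.norm_le_abs_re_add_abs_im _).trans ?_
    rw [Complex.log_re, Complex.log_im]
    gcongr
    exact Complex.abs_arg_le_pi u
  have hprod : Tendsto (fun z : ℂ => (1 - z) * Complex.log (b * (1 - z))) (𝓝[≠] 1) (𝓝 0) := by
    have h := (hlim.comp hu).const_mul b⁻¹
    rw [mul_zero] at h
    refine h.congr fun z => ?_
    simp only [Function.comp]
    field_simp
  have hO2 : (fun z : ℂ => Complex.log z * Complex.log (b * (1 - z))) =O[𝓝[≠] 1]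
      fun z => (1 - z) * Complex.log (b * (1 - z)) :=
    (hO.mono nhdsWithin_le_nhds).mul (Asymptotics.isBigO_refl _ _)
  have h5 := ((hlogc.tendsto.mono_left nhdsWithin_le_nhds).pow j).mul (hO2.trans_tendsto hprod)
  rw [mul_zero] at h5
  exact h5.congr fun z => by ring

/-- Let real `x` increase to `1` in the overlap formula: the series is continuous on the closed disk
and the logarithmic term tends to `0`. -/
theorem IsPolylogPair.right_one {m : ℕ} {Li A : ℂ → ℂ} (h : IsPolylogPair m Li A) (hm : 1 ≤ m) :
    A 1 = riemannZeta ((m + 1 : ℕ) : ℂ) := by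
  have hu : Tendsto (fun x : ℝ => (x : ℂ)) (𝓝[<] 1) (𝓝[≠] 1) := by
    refine tendsto_nhdsWithin_iff.2 ⟨?_, ?_⟩
    · exact (Complex.continuous_ofReal.tendsto' 1 1 (by simp)).mono_left nhdsWithin_le_nhds
    · filter_upwards [self_mem_nhdsWithin] with x hx
      have : x ≠ 1 := ne_of_lt hx
      simpa using this
  have hA : Tendsto (fun x : ℝ => A x) (𝓝[<] 1) (𝓝 (A 1)) :=
    ((h.differentiableOn_right.differentiableAt
      (Complex.isOpen_slitPlane.mem_nhds Complex.one_mem_slitPlane)).continuousAt.tendsto.mono_left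
        nhdsWithin_le_nhds).comp hu
  have hlog := ((tendsto_log_pow_mul_log hm one_ne_zero).comp hu).div_const (m.factorial : ℂ)
  have hdiff := hA.sub hlog
  rw [zero_div, sub_zero] at hdiff
  have hIoo : Set.Ioo (0 : ℝ) 1 ∈ 𝓝[<] (1 : ℝ) := Ioo_mem_nhdsLT one_pos
  have hser : Tendsto (fun x : ℝ => polylogSeries (m + 1) x) (𝓝[<] 1)
      (𝓝 (polylogSeries (m + 1) 1)) := by
    refine (continuousOn_polylogSeries (by lia : 2 ≤ m + 1) 1 (by simp)).tendsto.comp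
      (tendsto_nhdsWithin_iff.2 ⟨hu.mono_right nhdsWithin_le_nhds, ?_⟩)
    filter_upwards [hIoo] with x hx
    simpa [abs_le] using ⟨by linarith [hx.1], hx.2.le⟩
  rw [← polylogSeries_one_right (by lia : 2 ≤ m + 1)]
  refine tendsto_nhds_unique hdiff (hser.congr' ?_)
  filter_upwards [hIoo] with x hx
  have hx1 : ‖(x : ℂ)‖ < 1 := by simpa [abs_lt] using ⟨by linarith [hx.1], hx.2⟩
  rw [← h.eq_series _ hx1, h.eq_overlap _ (by simpa using hx.2) (Or.inl (by simpa using hx.1))]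
  simp only [Function.comp, one_mul]
  ring

/-! ### The correction terms `P`. -/

/-- Entire functions `P` for which `m! P` maps the periods `2πin` of the exponential into
`ℤ(m + 1)`. -/
structure IsPeriodIntegral (m : ℕ) (P : ℂ → ℂ) : Prop where
  differentiable : Differentiable ℂ P
  mem : ∀ n : ℤ, (m.factorial : ℂ) * P (n * (2 * Real.pi * Complex.I)) ∈ tateIntegers (m + 1)

theorem IsPeriodIntegral.zero (m : ℕ) : IsPeriodIntegral m fun _ => 0 :=
  ⟨differentiable_const _, fun n => by simp [zero_mem]⟩

/-- Effect of another logarithm of `z`; this is why all periods, not only `0`, enter the condition.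
-/
theorem IsPeriodIntegral.comp_add {m : ℕ} {P : ℂ → ℂ} (h : IsPeriodIntegral m P) (n : ℤ) :
    IsPeriodIntegral m fun w => P (w + n * (2 * Real.pi * Complex.I)) := by
  refine ⟨h.differentiable.comp (differentiable_id.add_const _), fun j => ?_⟩
  have := h.mem (j + n)
  rwa [Int.cast_add, add_mul] at this

/-- Effect of another logarithm of `1 - z`: at `2πij` the new term, times `m!`, is `n j ^ m (2πi) ^
(m + 1)`. -/
theorem IsPeriodIntegral.add_pow {m : ℕ} {P : ℂ → ℂ} (h : IsPeriodIntegral m P) (n : ℤ) :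
    IsPeriodIntegral m fun w =>
      P w + n * (2 * Real.pi * Complex.I) * (w ^ m / (m.factorial : ℂ)) := by
  refine ⟨h.differentiable.add (((differentiable_id.pow m).div_const _).const_mul _), fun j => ?_⟩
  rw [mul_add]
  refine add_mem (h.mem j) (AddSubgroup.mem_zmultiples_iff.2 ⟨n * j ^ m, ?_⟩)
  have hf : (m.factorial : ℂ) ≠ 0 := by exact_mod_cast m.factorial_ne_zero
  rw [zsmul_eq_mul]
  push_cast
  field_simp
  ring

/-! ### Logarithms, locally and on convex regions. -/

theorem Complex.exists_int_eventually_eq_add_of_exp {a b : ℂ → ℂ} {z : ℂ} (ha : ContinuousAt a z)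
    (hb : ContinuousAt b z) (h : ∀ᶠ w in 𝓝 z, Complex.exp (a w) = Complex.exp (b w)) :
    ∃ n : ℤ, ∀ᶠ w in 𝓝 z, a w = b w + n * (2 * Real.pi * Complex.I) := by
  obtain ⟨n, hn⟩ := Complex.exp_eq_exp_iff_exists_int.1 h.self_of_nhds
  refine ⟨n, ?_⟩
  have hc : ContinuousAt (fun w => a w - b w - n * (2 * Real.pi * Complex.I)) z := by fun_prop
  have h0 : a z - b z - n * (2 * Real.pi * Complex.I) = 0 := by rw [hn]; ring
  have hball := hc.preimage_mem_nhds (by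
    rw [h0]
    exact Metric.ball_mem_nhds (0 : ℂ) Real.pi_pos)
  filter_upwards [h, hball] with w hw hwb
  set u := a w - b w - n * (2 * Real.pi * Complex.I) with hu
  have hun : ‖u‖ < Real.pi := by simpa using hwb
  have him := abs_lt.1 ((Complex.abs_im_le_norm u).trans_lt hun)
  have hexp : Complex.exp u = 1 := by
    rw [hu, Complex.exp_sub, Complex.exp_int_mul_two_pi_mul_I, div_one, Complex.exp_sub, hw,
      div_self (Complex.exp_ne_zero _)]
  have hu0 : u = 0 := by
    rw [← Complex.log_exp him.1 him.2.le, hexp, Complex.log_one]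
  linear_combination hu0 - hu

theorem Convex.exists_re_mul_sub_pos {V : Set ℂ} (hV : Convex ℝ V) (ho : IsOpen V) {c : ℂ}
    (hc : c ∉ V) : ∃ a : ℂ, a ≠ 0 ∧ ∀ z ∈ V, 0 < (a * (z - c)).re := by
  obtain ⟨f, hf⟩ := geometric_hahn_banach_point_open hV ho hc
  rcases V.eq_empty_or_nonempty with rfl | ⟨p, hp⟩
  · exact ⟨1, one_ne_zero, by simp⟩
  -- A real-linear functional on `ℂ` is the real part of multiplication by a complex number.
  have key : ∀ w : ℂ, (((f 1 : ℝ) - (f Complex.I : ℝ) * Complex.I : ℂ) * w).re = f w := by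
    intro w
    have h : w = w.re • (1 : ℂ) + w.im • Complex.I := by simp
    conv_rhs => rw [h, map_add, map_smul, map_smul]
    simp
    ring
  have hpos : ∀ z ∈ V, 0 < (((f 1 : ℝ) - (f Complex.I : ℝ) * Complex.I : ℂ) * (z - c)).re := by
    intro z hz
    rw [key, map_sub, sub_pos]
    exact hf z hz
  refine ⟨_, fun h0 => ?_, hpos⟩
  have := hpos p hp
  rw [h0] at this
  simp at this

theorem Complex.exp_log_mul_sub_log {b w : ℂ} (hb : b ≠ 0) (hw : w ≠ 0) :
    Complex.exp (Complex.log (b * w) - Complex.log b) = w := by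
  rw [Complex.exp_sub, Complex.exp_log (mul_ne_zero hb hw), Complex.exp_log hb]
  field_simp

theorem Convex.exists_log {V : Set ℂ} (hV : Convex ℝ V) (ho : IsOpen V) (h0 : (0 : ℂ) ∉ V) :
    ∃ l : ℂ → ℂ, DifferentiableOn ℂ l V ∧ ∀ z ∈ V, Complex.exp (l z) = z := by
  obtain ⟨a, ha, hpos⟩ := hV.exists_re_mul_sub_pos ho h0
  simp only [sub_zero] at hpos
  refine ⟨fun z => Complex.log (a * z) - Complex.log a, ?_, fun z hz =>
    Complex.exp_log_mul_sub_log ha fun h => h0 (h ▸ hz)⟩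
  exact ((differentiableOn_id.const_mul a).clog fun z hz => Or.inl (hpos z hz)).sub_const _

/-- A rotation puts `1 - z` in the right half-plane. The logarithm stays explicit so that its growth
at `1` can be estimated. -/
theorem Convex.exists_log_one_sub {V : Set ℂ} (hV : Convex ℝ V) (ho : IsOpen V)
    (h1 : (1 : ℂ) ∉ V) : ∃ b : ℂ, b ≠ 0 ∧
      DifferentiableOn ℂ (fun z => Complex.log (b * (1 - z)) - Complex.log b) V ∧
      ∀ z ∈ V, Complex.exp (Complex.log (b * (1 - z)) - Complex.log b) = 1 - z := by
  obtain ⟨a, ha, hpos⟩ := hV.exists_re_mul_sub_pos ho h1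
  refine ⟨-a, neg_ne_zero.2 ha, ?_, fun z hz =>
    Complex.exp_log_mul_sub_log (neg_ne_zero.2 ha) (sub_ne_zero.2 fun h => h1 (h ▸ hz))⟩
  refine (((differentiableOn_const (1 : ℂ)).sub differentiableOn_id).const_mul (-a)).clog
    (fun z hz => Or.inl ?_) |>.sub_const _
  change 0 < (-a * (1 - z)).re
  rw [show -a * (1 - z) = a * (z - 1) by ring]
  exact hpos z hz

/-! ### Germs of branches in the two charts. -/

/-- The germ of `f` at `z` is a branch of the polylogarithm, expressed through the power series. -/
def IsLeftGerm (m : ℕ) (Li : ℂ → ℂ) (z : ℂ) (f : ℂ → ℂ) : Prop :=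
  ∃ l P : ℂ → ℂ, ContinuousAt l z ∧ (∀ᶠ w in 𝓝 z, Complex.exp (l w) = w) ∧
    IsPeriodIntegral m P ∧ ∀ᶠ w in 𝓝 z, f w = Li w + P (l w)

/-- The germ of `f` at `z` is a branch of the polylogarithm, expressed through its regular part
on the slit plane and a logarithm of `1 - z`. -/
def IsRightGerm (m : ℕ) (A : ℂ → ℂ) (z : ℂ) (f : ℂ → ℂ) : Prop :=
  ∃ u P : ℂ → ℂ, ContinuousAt u z ∧ (∀ᶠ w in 𝓝 z, Complex.exp (u w) = 1 - w) ∧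
    IsPeriodIntegral m P ∧ ∀ᶠ w in 𝓝 z,
      f w = A w - Complex.log w ^ m / (m.factorial : ℂ) * u w + P (Complex.log w)

/-- The germ of `f` at `z` is a branch of the polylogarithm of weight `m + 1`. -/
def IsPolylogGerm (m : ℕ) (Li A : ℂ → ℂ) (z : ℂ) (f : ℂ → ℂ) : Prop :=
  (z.re < 1 ∧ IsLeftGerm m Li z f) ∨ (z ∈ Complex.slitPlane ∧ IsRightGerm m A z f)

/-- The logarithm may be prescribed: the change by a period is absorbed into `P`. -/
theorem IsLeftGerm.exists_eq {m : ℕ} {Li f l : ℂ → ℂ} {z : ℂ} (h : IsLeftGerm m Li z f)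
    (hl : ContinuousAt l z) (hexp : ∀ᶠ w in 𝓝 z, Complex.exp (l w) = w) :
    ∃ P, IsPeriodIntegral m P ∧ ∀ᶠ w in 𝓝 z, f w = Li w + P (l w) := by
  obtain ⟨l', P, hl', hexp', hP, hf⟩ := h
  obtain ⟨n, hn⟩ := Complex.exists_int_eventually_eq_add_of_exp hl' hl (by
    filter_upwards [hexp, hexp'] with w h1 h2 using h2.trans h1.symm)
  refine ⟨_, hP.comp_add n, ?_⟩
  filter_upwards [hn, hf] with w h1 h2
  rw [h2, h1]

theorem IsRightGerm.exists_eq {m : ℕ} {A f u : ℂ → ℂ} {z : ℂ} (h : IsRightGerm m A z f)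
    (hu : ContinuousAt u z) (hexp : ∀ᶠ w in 𝓝 z, Complex.exp (u w) = 1 - w) :
    ∃ P, IsPeriodIntegral m P ∧ ∀ᶠ w in 𝓝 z,
      f w = A w - Complex.log w ^ m / (m.factorial : ℂ) * u w + P (Complex.log w) := by
  obtain ⟨u', P, hu', hexp', hP, hf⟩ := h
  obtain ⟨n, hn⟩ := Complex.exists_int_eventually_eq_add_of_exp hu' hu (by
    filter_upwards [hexp, hexp'] with w h1 h2 using h2.trans h1.symm)
  refine ⟨_, hP.add_pow (-n), ?_⟩
  filter_upwards [hn, hf] with w h1 h2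
  rw [h2, h1]
  push_cast
  ring

/-- With the principal logarithms of `z` and `1 - z`, the overlap formula exchanges the two forms
with the same `P`. -/
theorem IsPolylogPair.isLeftGerm_iff_isRightGerm {m : ℕ} {Li A f : ℂ → ℂ}
    (h : IsPolylogPair m Li A) {z : ℂ} (hz1 : z.re < 1) (hz : z ∈ Complex.slitPlane) :
    IsLeftGerm m Li z f ↔ IsRightGerm m A z f := by
  have hev : ∀ᶠ w in 𝓝 z, w.re < 1 ∧ w ∈ Complex.slitPlane :=
    ((isOpen_lt Complex.continuous_re continuous_const).eventually_mem hz1).and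
      (Complex.isOpen_slitPlane.eventually_mem hz)
  have hl : ContinuousAt Complex.log z := (Complex.differentiableAt_log hz).continuousAt
  have hlexp : ∀ᶠ w in 𝓝 z, Complex.exp (Complex.log w) = w := by
    filter_upwards [hev] with w hw using Complex.exp_log (Complex.slitPlane_ne_zero hw.2)
  have hu : ContinuousAt (fun w => Complex.log (1 - w)) z :=
    (continuousAt_const.sub continuousAt_id).clog (one_sub_mem_slitPlane hz1)
  have huexp : ∀ᶠ w in 𝓝 z, Complex.exp (Complex.log (1 - w)) = 1 - w := by
    filter_upwards [hev] with w hw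
    exact Complex.exp_log (Complex.slitPlane_ne_zero (one_sub_mem_slitPlane hw.1))
  constructor
  · intro hL
    obtain ⟨P, hP, hf⟩ := hL.exists_eq hl hlexp
    refine ⟨_, P, hu, huexp, hP, ?_⟩
    filter_upwards [hf, hev] with w h1 h2
    rw [h1, h.eq_overlap w h2.1 h2.2]
  · intro hR
    obtain ⟨P, hP, hf⟩ := hR.exists_eq hu huexp
    refine ⟨_, P, hl, hlexp, hP, ?_⟩
    filter_upwards [hf, hev] with w h1 h2
    rw [h1, h.eq_overlap w h2.1 h2.2]

theorem IsPolylogGerm.isLeftGerm {m : ℕ} {Li A f : ℂ → ℂ} {z : ℂ} (hf : IsPolylogGerm m Li A z f)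
    (h : IsPolylogPair m Li A) (hz : z.re < 1) : IsLeftGerm m Li z f :=
  hf.elim And.right fun h' => (h.isLeftGerm_iff_isRightGerm hz h'.1).2 h'.2

theorem IsPolylogGerm.isRightGerm {m : ℕ} {Li A f : ℂ → ℂ} {z : ℂ}
    (hf : IsPolylogGerm m Li A z f) (h : IsPolylogPair m Li A) (hz : z ∈ Complex.slitPlane) :
    IsRightGerm m A z f :=
  hf.elim (fun h' => (h.isLeftGerm_iff_isRightGerm h'.1 hz).1 h'.2) And.right

theorem IsPolylogGerm.congr {m : ℕ} {Li A f g : ℂ → ℂ} {z : ℂ} (hf : IsPolylogGerm m Li A z f)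
    (hfg : f =ᶠ[𝓝 z] g) : IsPolylogGerm m Li A z g := by
  rcases hf with ⟨hz, l, P, h1, h2, h3, h4⟩ | ⟨hz, l, P, h1, h2, h3, h4⟩
  · exact Or.inl ⟨hz, l, P, h1, h2, h3, by
      filter_upwards [h4, hfg] with w h5 h6 using h6 ▸ h5⟩
  · exact Or.inr ⟨hz, l, P, h1, h2, h3, by
      filter_upwards [h4, hfg] with w h5 h6 using h6 ▸ h5⟩

/-! ### Extension of germs over convex regions. -/

/-- Convex regions of `ℂ - {0, 1}` contained in one of the two charts. -/
structure IsConvexChartRegion (V : Set ℂ) : Prop where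
  isOpen : IsOpen V
  convex : Convex ℝ V
  zero_notMem : (0 : ℂ) ∉ V
  one_notMem : (1 : ℂ) ∉ V
  subset : V ⊆ {z : ℂ | z.re < 1} ∨ V ⊆ Complex.slitPlane

theorem IsPolylogPair.exists_eqOn_right {m : ℕ} {Li A f : ℂ → ℂ} (h : IsPolylogPair m Li A)
    {V : Set ℂ} (hV : IsConvexChartRegion V) (hVs : V ⊆ Complex.slitPlane) {z : ℂ} (hz : z ∈ V)
    (hf : IsPolylogGerm m Li A z f) :
    ∃ (b : ℂ) (P : ℂ → ℂ), b ≠ 0 ∧ IsPeriodIntegral m P ∧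
      ∃ F : ℂ → ℂ, F = (fun w => A w - Complex.log w ^ m / (m.factorial : ℂ) *
        (Complex.log (b * (1 - w)) - Complex.log b) + P (Complex.log w)) ∧
      DifferentiableOn ℂ F V ∧ F =ᶠ[𝓝 z] f ∧ ∀ w ∈ V, IsPolylogGerm m Li A w F := by
  obtain ⟨b, hb, hd, hexp⟩ := hV.convex.exists_log_one_sub hV.isOpen hV.one_notMem
  have hc : ∀ w ∈ V, ContinuousAt (fun z => Complex.log (b * (1 - z)) - Complex.log b) w :=
    fun w hw => (hd.differentiableAt (hV.isOpen.mem_nhds hw)).continuousAt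
  have he : ∀ w ∈ V, ∀ᶠ y in 𝓝 w,
      Complex.exp (Complex.log (b * (1 - y)) - Complex.log b) = 1 - y := fun w hw => by
    filter_upwards [hV.isOpen.mem_nhds hw] with y hy using hexp y hy
  obtain ⟨P, hP, hfP⟩ := (hf.isRightGerm h (hVs hz)).exists_eq (hc z hz) (he z hz)
  have hlog : DifferentiableOn ℂ Complex.log V :=
    fun w hw => (Complex.differentiableAt_log (hVs hw)).differentiableWithinAt
  refine ⟨b, P, hb, hP, _, rfl, ?_, ?_, fun w hw => Or.inr ⟨hVs hw, _, P, hc w hw, he w hw, hP,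
    Eventually.of_forall fun _ => rfl⟩⟩
  · exact ((h.differentiableOn_right.mono hVs).sub (((hlog.pow m).div_const _).mul hd)).add
      (hP.differentiable.comp_differentiableOn hlog)
  · filter_upwards [hfP] with w hw using hw.symm

theorem IsPolylogPair.exists_extension {m : ℕ} {Li A f : ℂ → ℂ} (h : IsPolylogPair m Li A)
    {V : Set ℂ} (hV : IsConvexChartRegion V) {z : ℂ} (hz : z ∈ V)
    (hf : IsPolylogGerm m Li A z f) :
    ∃ F : ℂ → ℂ, DifferentiableOn ℂ F V ∧ F =ᶠ[𝓝 z] f ∧ ∀ w ∈ V, IsPolylogGerm m Li A w F := by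
  rcases hV.subset with hVs | hVs
  · obtain ⟨l, hd, hexp⟩ := hV.convex.exists_log hV.isOpen hV.zero_notMem
    have hc : ∀ w ∈ V, ContinuousAt l w :=
      fun w hw => (hd.differentiableAt (hV.isOpen.mem_nhds hw)).continuousAt
    have he : ∀ w ∈ V, ∀ᶠ y in 𝓝 w, Complex.exp (l y) = y := fun w hw => by
      filter_upwards [hV.isOpen.mem_nhds hw] with y hy using hexp y hy
    obtain ⟨P, hP, hfP⟩ := (hf.isLeftGerm h (hVs hz)).exists_eq (hc z hz) (he z hz)
    refine ⟨fun w => Li w + P (l w), ?_, ?_, fun w hw => Or.inl ⟨hVs hw, l, P, hc w hw, he w hw,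
      hP, Eventually.of_forall fun _ => rfl⟩⟩
    · exact (h.differentiableOn_left.mono hVs).add (hP.differentiable.comp_differentiableOn hd)
    · filter_upwards [hfP] with w hw using hw.symm
  · obtain ⟨_, _, _, _, F, -, hF⟩ := h.exists_eqOn_right hV hVs hz hf
    exact ⟨F, hF⟩

theorem IsConvexChartRegion.eqOn_of_eventuallyEq {V : Set ℂ} (hV : IsConvexChartRegion V)
    {F f : ℂ → ℂ} {z : ℂ} (hz : z ∈ V) (hF : DifferentiableOn ℂ F V) (hf : DifferentiableOn ℂ f V)
    (hFf : F =ᶠ[𝓝 z] f) : Set.EqOn F f V :=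
  (hF.analyticOnNhd hV.isOpen).eqOn_of_preconnected_of_eventuallyEq
    (hf.analyticOnNhd hV.isOpen) hV.convex.isPreconnected hz hFf

theorem IsPolylogGerm.of_mem {m : ℕ} {Li A f : ℂ → ℂ} (h : IsPolylogPair m Li A)
    {V : Set ℂ} (hV : IsConvexChartRegion V) (hd : DifferentiableOn ℂ f V) {z w : ℂ} (hz : z ∈ V)
    (hw : w ∈ V) (hf : IsPolylogGerm m Li A z f) : IsPolylogGerm m Li A w f := by
  obtain ⟨F, hFd, hFf, hF⟩ := h.exists_extension hV hz hf
  refine (hF w hw).congr ?_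
  filter_upwards [hV.isOpen.mem_nhds hw] with y hy
  exact hV.eqOn_of_eventuallyEq hz hFd hd hFf hy

theorem exists_isConvexChartRegion_subset {z : ℂ} (h0 : z ≠ 0) (h1 : z ≠ 1) {s : Set ℂ}
    (hs : s ∈ 𝓝 z) : ∃ V, IsConvexChartRegion V ∧ z ∈ V ∧ V ⊆ s := by
  have hchart : ∃ U : Set ℂ, IsOpen U ∧ z ∈ U ∧
      (U ⊆ {z : ℂ | z.re < 1} ∨ U ⊆ Complex.slitPlane) := by
    rcases lt_or_ge z.re 1 with h | h
    · exact ⟨_, isOpen_lt Complex.continuous_re continuous_const, h, Or.inl subset_rfl⟩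
    · exact ⟨_, Complex.isOpen_slitPlane, Or.inl (by linarith), Or.inr subset_rfl⟩
  obtain ⟨U, hU, hzU, hUs⟩ := hchart
  have hmem : s ∩ U ∩ {0}ᶜ ∩ {1}ᶜ ∈ 𝓝 z :=
    inter_mem (inter_mem (inter_mem hs (hU.mem_nhds hzU)) (isOpen_compl_singleton.mem_nhds h0))
      (isOpen_compl_singleton.mem_nhds h1)
  obtain ⟨r, hr, hball⟩ := Metric.mem_nhds_iff.1 hmem
  exact ⟨Metric.ball z r, ⟨Metric.isOpen_ball, convex_ball z r, fun h => (hball h).1.2 rfl,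
    fun h => (hball h).2 rfl, hUs.imp (fun h w hw => h (hball hw).1.1.2)
      fun h w hw => h (hball hw).1.1.2⟩, Metric.mem_ball_self hr, fun w hw => (hball hw).1.1.1⟩

/-! ### Continuation along paths. -/

/-- Being a polylogarithm germ is a locally constant property along the path, and the unit interval
is connected. -/
theorem IsPolylogGerm.of_continuation {m : ℕ} {Li A f g : ℂ → ℂ} (hp : IsPolylogPair m Li A)
    {a b : ℂ} {γ : Path a b} (hγ : ∀ t, γ t ≠ 0 ∧ γ t ≠ 1)
    (hfg : IsAnalyticContinuationAlong γ f g) (hf : IsPolylogGerm m Li A a f) :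
    IsPolylogGerm m Li A b g := by
  obtain ⟨h, han, hloc, h0, h1⟩ := hfg
  have hconst : IsLocallyConstant fun t => IsPolylogGerm m Li A (γ t) (h t) := by
    refine (IsLocallyConstant.iff_eventually_eq _).2 fun t => ?_
    obtain ⟨V, hV, htV, hVs⟩ := exists_isConvexChartRegion_subset (hγ t).1 (hγ t).2
      (han t).eventually_analyticAt
    have hd : DifferentiableOn ℂ (h t) V :=
      fun w hw => (hVs hw).differentiableAt.differentiableWithinAt
    filter_upwards [hloc t, γ.continuous.continuousAt.preimage_mem_nhds (hV.isOpen.mem_nhds htV)]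
      with s hs hsV
    exact propext ⟨fun H => .of_mem hp hV hd hsV htV (H.congr hs),
      fun H => (IsPolylogGerm.of_mem hp hV hd htV hsV H).congr hs.symm⟩
  have heq := hconst.apply_eq_of_preconnectedSpace 0 1
  simp only [Path.source, Path.target] at heq
  exact (heq.mp (hf.congr h0.symm)).congr h1

theorem IsPolylogGerm.exists_continuation {m : ℕ} {Li A f : ℂ → ℂ} (hp : IsPolylogPair m Li A)
    {a b : ℂ} {γ : Path a b} (hγ : ∀ t, γ t ≠ 0 ∧ γ t ≠ 1) (hfa : AnalyticAt ℂ f a)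
    (hf : IsPolylogGerm m Li A a f) : ∃ g, IsAnalyticContinuationAlong γ f g := by
  choose V hV hmem _ using fun t : unitInterval =>
    exists_isConvexChartRegion_subset (hγ t).1 (hγ t).2 univ_mem
  obtain ⟨t, ht0, htm, ⟨N, hN⟩, hsub⟩ := exists_monotone_Icc_subset_open_cover_unitInterval
    (c := fun t => γ ⁻¹' V t) (fun t => (hV t).isOpen.preimage γ.continuous)
    (fun t _ => Set.mem_iUnion.2 ⟨t, hmem t⟩)
  -- Continuation up to `t n`. Local constancy is asked only for `r ≤ t n`; the last clause lets the
  -- germ extend over the next region.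
  have key : ∀ n, ∃ h : unitInterval → ℂ → ℂ, (∀ s ≤ t n, AnalyticAt ℂ (h s) (γ s)) ∧
      (∀ s ≤ t n, ∀ᶠ r in 𝓝 s, r ≤ t n → h r =ᶠ[𝓝 (γ r)] h s) ∧ h 0 =ᶠ[𝓝 a] f ∧
      IsPolylogGerm m Li A (γ (t n)) (h (t n)) := by
    intro n
    induction n with
    | zero =>
      refine ⟨fun _ => f, fun s hs => ?_, fun s _ => Eventually.of_forall fun r _ => .rfl, .rfl, ?_⟩
      · have : s = 0 := le_antisymm (ht0 ▸ hs) bot_le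
        rw [this, γ.source]
        exact hfa
      · rw [ht0, γ.source]
        exact hf
    | succ n ih =>
      obtain ⟨h, han, hloc, h0, hg⟩ := ih
      obtain ⟨i, hi⟩ := hsub n
      have hle : t n ≤ t (n + 1) := htm n.le_succ
      obtain ⟨F, hFd, hFh, hF⟩ := hp.exists_extension (hV i) (hi ⟨le_rfl, hle⟩) hg
      have hFan : ∀ w ∈ V i, AnalyticAt ℂ F w := hFd.analyticOnNhd (hV i).isOpen
      let h' : unitInterval → ℂ → ℂ := fun s => if s ≤ t n then h s else F
      have hle' : ∀ s ≤ t n, h' s = h s := fun s hs => if_pos hs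
      have hgt' : ∀ s, t n < s → h' s = F := fun s hs => if_neg hs.not_ge
      -- The subdivision is only weakly monotone, so consecutive points may coincide.
      have hendF : h' (t (n + 1)) =ᶠ[𝓝 (γ (t (n + 1)))] F := by
        rcases hle.eq_or_lt with he | hlt
        · rw [← he, hle' _ le_rfl]
          exact hFh.symm
        · rw [hgt' _ hlt]
      refine ⟨h', fun s hs => ?_, fun s hs => ?_, ?_, ?_⟩
      · rcases le_or_gt s (t n) with h1 | h1
        · rw [hle' s h1]
          exact han s h1
        · rw [hgt' s h1]
          exact hFan _ (hi ⟨h1.le, hs⟩)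
      · rcases lt_trichotomy s (t n) with h1 | h1 | h1
        · filter_upwards [hloc s h1.le, eventually_lt_nhds h1] with r hr hrt _
          rw [hle' r hrt.le, hle' s h1.le]
          exact hr hrt.le
        · have hFev : ∀ᶠ r in 𝓝 s, F =ᶠ[𝓝 (γ r)] h s := by
            rw [← h1] at hFh
            exact γ.continuous.continuousAt.eventually hFh.eventuallyEq_nhds
          filter_upwards [hloc s h1.le, hFev] with r hr hrF _
          rw [hle' s h1.le]
          rcases le_or_gt r (t n) with h2 | h2
          · rw [hle' r h2]
            exact hr h2
          · rw [hgt' r h2]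
            exact hrF
        · filter_upwards [eventually_gt_nhds h1] with r hr _
          rw [hgt' r hr, hgt' s h1]
      · rw [hle' 0 bot_le]
        exact h0
      · exact (hF _ (hi ⟨hle, le_rfl⟩)).congr hendF.symm
  obtain ⟨h, han, hloc, h0, -⟩ := key N
  rw [hN N le_rfl] at han hloc
  exact ⟨h 1, h, fun s => han s le_top, fun s => by
    filter_upwards [hloc s le_top] with r hr using hr le_top, h0, .rfl⟩

theorem IsPolylogPair.isPolylogGerm_polylogSeries {m : ℕ} {Li A : ℂ → ℂ}
    (h : IsPolylogPair m Li A) : IsPolylogGerm m Li A (1 / 2) (polylogSeries (m + 1)) := by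
  have hz : (1 / 2 : ℂ) ∈ Complex.slitPlane := Or.inl (by norm_num)
  refine Or.inl ⟨by norm_num, Complex.log, _, (Complex.differentiableAt_log hz).continuousAt, ?_,
    .zero m, ?_⟩
  · filter_upwards [Complex.isOpen_slitPlane.mem_nhds hz] with w hw
    exact Complex.exp_log (Complex.slitPlane_ne_zero hw)
  · have hball : Metric.ball (0 : ℂ) 1 ∈ 𝓝 (1 / 2) := Metric.isOpen_ball.mem_nhds (by norm_num)
    filter_upwards [hball] with w hw
    rw [h.eq_series w (by simpa using hw), add_zero]

theorem analyticAt_polylogSeries (k : ℕ) : AnalyticAt ℂ (polylogSeries (k + 1)) (1 / 2) := by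
  have hd : DifferentiableOn ℂ (polylogSeries (k + 1)) (Metric.ball 0 1) := fun z hz =>
    (hasDerivAt_polylogSeries k (by simpa using hz)).differentiableAt.differentiableWithinAt
  exact hd.analyticAt (Metric.isOpen_ball.mem_nhds (by norm_num))

/-! ### Limits at `1` and the conclusion. -/

/-- The open segment from a negative real point of `V` to `1` lies in `V`, although `1` is only
adherent, and it contains `0`. -/
theorem IsConvexRegionAtOne.subset_slitPlane {V : Set ℂ} (hV : IsConvexRegionAtOne V) :
    V ⊆ Complex.slitPlane := by
  intro z hz
  by_contra hns
  rw [Complex.mem_slitPlane_iff, not_or, not_lt, not_not] at hns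
  obtain ⟨hre, him⟩ := hns
  have hzx : z = (z.re : ℂ) := Complex.ext rfl (by simpa using him)
  have hlt : z.re < 0 := lt_of_le_of_ne hre fun h0 => hV.zero_notMem (by
    rw [h0] at hzx
    simpa [hzx] using hz)
  have hseg := hV.convex.openSegment_interior_closure_subset_interior
    (hV.isOpen.interior_eq.symm ▸ hz) hV.one_mem_closure
  refine hV.zero_notMem (interior_subset (hseg ?_))
  have hpos : 0 < 1 - z.re := by linarith
  refine ⟨1 / (1 - z.re), -z.re / (1 - z.re), by positivity, div_pos (by linarith) hpos, ?_, ?_⟩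
  · field_simp
    ring
  · have hne : (1 : ℂ) - z.re ≠ 0 := by exact_mod_cast hpos.ne'
    rw [hzx]
    simp only [Complex.real_smul, Complex.ofReal_re]
    push_cast
    field_simp
    ring

theorem IsConvexRegionAtOne.isConvexChartRegion {V : Set ℂ} (hV : IsConvexRegionAtOne V) :
    IsConvexChartRegion V :=
  ⟨hV.isOpen, hV.convex, hV.zero_notMem, hV.one_notMem, Or.inr hV.subset_slitPlane⟩

theorem IsPolylogPair.exists_tendsto {m : ℕ} (hm : 1 ≤ m) {Li A F : ℂ → ℂ}
    (h : IsPolylogPair m Li A) {V : Set ℂ} (hV : IsConvexRegionAtOne V) {p : ℂ} (hp : p ∈ V)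
    (hF : AnalyticOnNhd ℂ F V) (hg : IsPolylogGerm m Li A p F) :
    ∃ P, IsPeriodIntegral m P ∧
      Tendsto F (𝓝[V] 1) (𝓝 (riemannZeta ((m + 1 : ℕ) : ℂ) + P 0)) := by
  have hVc := hV.isConvexChartRegion
  obtain ⟨b, P, hb, hP, G, hG, hGd, hGF, -⟩ :=
    h.exists_eqOn_right hVc hV.subset_slitPlane hp hg
  refine ⟨P, hP, ?_⟩
  have heq := hVc.eqOn_of_eventuallyEq hp hGd hF.differentiableOn hGF
  refine Tendsto.congr' (f₁ := G) ?_ ?_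
  · filter_upwards [self_mem_nhdsWithin] with w hw using heq hw
  · have hle : 𝓝[V] (1 : ℂ) ≤ 𝓝[≠] 1 :=
      nhdsWithin_mono 1 fun w hw h1 => hV.one_notMem (h1 ▸ hw)
    refine Tendsto.mono_left ?_ hle
    have hlog : Tendsto Complex.log (𝓝[≠] 1) (𝓝 0) := by
      have := (Complex.differentiableAt_log Complex.one_mem_slitPlane).continuousAt.tendsto
      rw [Complex.log_one] at this
      exact this.mono_left nhdsWithin_le_nhds
    have hA : Tendsto A (𝓝[≠] 1) (𝓝 (riemannZeta ((m + 1 : ℕ) : ℂ))) := by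
      rw [← h.right_one hm]
      exact (h.differentiableOn_right.differentiableAt (Complex.isOpen_slitPlane.mem_nhds
        Complex.one_mem_slitPlane)).continuousAt.tendsto.mono_left nhdsWithin_le_nhds
    have hT := (((tendsto_log_pow_mul_log hm hb).sub
      ((hlog.pow m).mul_const (Complex.log b))).div_const (m.factorial : ℂ))
    have hall := (hA.sub hT).add ((hP.differentiable.continuous.tendsto 0).comp hlog)
    rw [zero_pow (by lia), zero_mul, sub_zero, zero_div, sub_zero] at hall
    refine hall.congr fun w => ?_
    rw [hG]
    simp only [Function.comp]
    ring

theorem isConvexRegionAtOne_ball : IsConvexRegionAtOne (Metric.ball (1 / 2) (1 / 2)) where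
  isOpen := Metric.isOpen_ball
  convex := convex_ball _ _
  zero_notMem := by norm_num [dist_eq_norm]
  one_notMem := by norm_num [dist_eq_norm]
  one_mem_closure := by
    rw [closure_ball _ (by norm_num)]
    norm_num [dist_eq_norm]

theorem mainTheorem10 (k : ℕ) (hk : 2 ≤ k) :
    (∀ V : Set ℂ, IsConvexRegionAtOne V →
      ∀ p ∈ V, ∀ γ : Path (1 / 2 : ℂ) p, (∀ t, γ t ≠ 0 ∧ γ t ≠ 1) →
        (∃ F : ℂ → ℂ, IsPolylogBranchAlong k γ V F) ∧
        ∀ F : ℂ → ℂ, IsPolylogBranchAlong k γ V F → ∃ L : ℂ, Tendsto F (𝓝[V] 1) (𝓝 L)) ∧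
    (fun L : ℂ => (QuotientAddGroup.mk (((k - 1).factorial : ℂ) * L) : ℂ ⧸ tateIntegers k)) ''
        polylogValuesAtOne k =
      {QuotientAddGroup.mk (((k - 1).factorial : ℂ) * riemannZeta (k : ℂ))} := by
  obtain ⟨m, rfl⟩ := Nat.exists_eq_add_of_le' (by lia : 1 ≤ k)
  have hm : 1 ≤ m := by lia
  rw [Nat.add_sub_cancel]
  obtain ⟨Li, A, h⟩ := exists_isPolylogPair m
  have hlim : ∀ V : Set ℂ, IsConvexRegionAtOne V → ∀ p ∈ V, ∀ γ : Path (1 / 2 : ℂ) p,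
      (∀ t, γ t ≠ 0 ∧ γ t ≠ 1) → ∀ F : ℂ → ℂ, IsPolylogBranchAlong (m + 1) γ V F →
      ∃ P, IsPeriodIntegral m P ∧
        Tendsto F (𝓝[V] 1) (𝓝 (riemannZeta ((m + 1 : ℕ) : ℂ) + P 0)) :=
    fun V hV p hp γ hγ F hF => h.exists_tendsto hm hV hp hF.1
      (.of_continuation h hγ hF.2 h.isPolylogGerm_polylogSeries)
  have hex : ∀ V : Set ℂ, IsConvexRegionAtOne V → ∀ p ∈ V, ∀ γ : Path (1 / 2 : ℂ) p,
      (∀ t, γ t ≠ 0 ∧ γ t ≠ 1) → ∃ F : ℂ → ℂ, IsPolylogBranchAlong (m + 1) γ V F := by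
    intro V hV p hp γ hγ
    obtain ⟨g, hg⟩ := IsPolylogGerm.exists_continuation h hγ (analyticAt_polylogSeries m)
      h.isPolylogGerm_polylogSeries
    obtain ⟨F, hFd, hFg, -⟩ := h.exists_extension hV.isConvexChartRegion hp
      (.of_continuation h hγ hg h.isPolylogGerm_polylogSeries)
    obtain ⟨H, h1, h2, h3, h4⟩ := hg
    exact ⟨F, hFd.analyticOnNhd hV.isOpen, H, h1, h2, h3, h4.trans hFg.symm⟩
  refine ⟨fun V hV p hp γ hγ => ⟨hex V hV p hp γ hγ, fun F hF => ?_⟩, ?_⟩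
  · obtain ⟨P, -, hP⟩ := hlim V hV p hp γ hγ F hF
    exact ⟨_, hP⟩
  -- Nonemptiness comes from the constant path at `1 / 2` in the disk.
  · refine (Set.Nonempty.subset_singleton_iff (Set.Nonempty.image _ ?_)).1 ?_
    · have hp : (1 / 2 : ℂ) ∈ Metric.ball (1 / 2 : ℂ) (1 / 2) :=
        Metric.mem_ball_self (by norm_num)
      have hγ : ∀ t, Path.refl (1 / 2 : ℂ) t ≠ 0 ∧ Path.refl (1 / 2 : ℂ) t ≠ 1 := by
        intro t
        rw [Path.refl_apply]
        norm_num
      obtain ⟨F, hF⟩ := hex _ isConvexRegionAtOne_ball _ hp _ hγ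
      obtain ⟨P, -, hP⟩ := hlim _ isConvexRegionAtOne_ball _ hp _ hγ F hF
      exact ⟨_, _, isConvexRegionAtOne_ball, _, hp, _, hγ, F, hF, hP⟩
    · rintro _ ⟨L, ⟨V, hV, p, hp, γ, hγ, F, hF, hL⟩, rfl⟩
      obtain ⟨P, hP, hPF⟩ := hlim V hV p hp γ hγ F hF
      have := mem_closure_iff_nhdsWithin_neBot.1 hV.one_mem_closure
      rw [tendsto_nhds_unique hL hPF, Set.mem_singleton_iff, eq_comm, QuotientAddGroup.eq]
      -- Only the period `0` matters here, since `log z → 0` as `z → 1`.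
      have hmem := hP.mem 0
      rw [Int.cast_zero, zero_mul] at hmem
      rwa [mul_add, neg_add_cancel_left]
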